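/- Proposition (Lower Bound via RGLM-Denoiser). \emph{Setting.} Let $\mathcal G$ be a random graph (a random element of a measurable space) with a fixed finite node set $\mathcal V$, let $g$ be a measurable encoder, and let $\mathbf E=g(\mathcal G)\in\mathbb R^{\mathcal V\times d}$ be the latent node representations, with $\mathbb E\|\mathbf E\|_2^2<\infty$. Put $n=|\mathcal V|\,d$. Let $\boldsymbol s^G=(\boldsymbol s^G_1,\dots,\boldsymbol s^G_N)$ be any random sequence of hidden graph tokens in $\mathbb R^m$ on the same probability space, and let $\mathbf H=(\mathbf h_v)_{v\in\mathcal V}$ with $\mathbf h_v=\frac1{|\Gamma(v)|}\sum_{i\in\Gamma(v)}\boldsymbol s^G_i$ for given index sets $\Gamma(v)\subseteq\{1,\dots,N\}$ (an empty mean being $0$). Let $T\ge1$, $\beta_1,\dots,\beta_T\in(0,1)$, $\alpha_t=1-\beta_t$, $\bar\alpha_t=\prod_{i=1}^t\alpha_i$, $\lambda_1,\dots,\lambda_T>0$ and $\lambda_l>0$. Let $f(\cdot,\cdot,t)$, $1\le t\le T$, be any measurable denoiser (which predicts the noise from the noisy input, the condition and the time) whose expected squared noise prediction errors are finite, and let $$\mathcal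 L_{\rm diff}=\sum_{t=1}^T\lambda_t\,\mathbb E\big\|f\big(\sqrt{\bar\alpha_t}\,\mathbf E+\sqrt{1-\bar\alpha_t}\,\boldsymbol\epsilon,\ \mathbf H,\ t\big)-\boldsymbol\epsilon\big\|_2^2,$$ where $\boldsymbol\epsilon\sim\mathcal N(\mathbf 0,\mathbf I)$ is independent of $(\mathbf E,\mathbf H)$; the weights $\lambda_t=1/T$ give the expectation over a uniformly random time $t$. \emph{Model.} Let $$\sigma_t^2=\frac{\beta_t^2}{2\lambda_l\lambda_t\,\alpha_t(1-\bar\alpha_t)},\qquad \boldsymbol\mu_f(y,h,t)=\frac1{\sqrt{\alpha_t}}\Big(y-\frac{1-\alpha_t}{\sqrt{1-\bar\alpha_t}}\,f(y,h,t)\Big),$$ and let $q_f(x_0\mid h)=\int \mathcal N(x_T;\mathbf 0,\mathbf I)\prod_{t=1}^T\mathcal N\big(x_{t-1};\boldsymbol\mu_f(x_t,h,t),\sigma_t^2\mathbf I\big)\,dx_1\cdots dx_T$ be the conditional likelihood of the reverse diffusion. With $\tilde\beta_t=\beta_t(1-\bar\alpha_{t-1})/(1-\bar\alpha_t)$, put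 $$\mathrm C=\frac n2\log(2\pi)+\frac{\bar\alpha_T\,\mathbb E\|\mathbf E\|_2^2+n(1-\bar\alpha_T)}2+\frac n2\sum_{t=1}^T\Big(\log\frac{\sigma_t^2}{\beta_t}+\frac{\tilde\beta_t}{\sigma_t^2}-1\Big),$$ which does not depend on $\boldsymbol s^G$, on $\mathbf H$ or on $f$. Let $\mathcal H(\mathbf E)\in[-\infty,\infty)$ be the differential entropy ($-\infty$ if $\mathbf E$ has no density), and let $\mathcal I(\mathcal G;\boldsymbol s^G)\in[0,\infty]$ be the mutual information, i.e. the Kullback--Leibler divergence of the joint law from the product of the marginals. \emph{Claim.} The random variable $\log q_f(\mathbf E\mid\mathbf H)$ is integrable and satisfies the diffusion ELBO $$\mathbb E[-\log q_f(\mathbf E\mid\mathbf H)]\le\lambda_l\,\mathcal L_{\rm diff}+\mathrm C .$$ Moreover $$\mathcal I(\mathcal G;\boldsymbol s^G)\ \ge\ \mathcal H(\mathbf E)+\mathbb E[\log q_f(\mathbf E\mid\mathbf H)],\qquad \mathcal I(\mathcal G;\boldsymbol s^G)\ \ge\ \mathcal H(\mathbf E)-(\lambda_l\,\mathcal L_{\rm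 diff}+\mathrm C).$$ -/

import Mathlib

open MeasureTheory ProbabilityTheory InformationTheory
open scoped ENNReal

noncomputable section

namespace Denoiser

/-! ### Information quantities -/

/-- Mutual information `I(X; Y) = KL(P_(X,Y) ‖ P_X ⊗ P_Y)`, with values in `[0, ∞]`. -/
def mutualInfo {Ω 𝓧 𝓨 : Type*} [MeasurableSpace Ω] [MeasurableSpace 𝓧] [MeasurableSpace 𝓨]
    (P : Measure Ω) (X : Ω → 𝓧) (Y : Ω → 𝓨) : ℝ≥0∞ :=
  klDiv (P.map fun ω => (X ω, Y ω)) ((P.map X).prod (P.map Y))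

open scoped Classical in
/-- Differential entropy `h(μ) = ∫ (-p log p) dx` of a law `μ` with Lebesgue density `p`, as an
extended real: the integral of the positive part minus the integral of the negative part.
As usual, `h(μ) = -∞` when `μ` has no density. -/
def diffEntropy {ι : Type*} [Fintype ι] (μ : Measure (EuclideanSpace ℝ ι)) : EReal :=
  if μ ≪ volume then
    ((∫⁻ x, ENNReal.ofReal (Real.negMulLog (μ.rnDeriv volume x).toReal) : ℝ≥0∞) : EReal)
      - ((∫⁻ x, ENNReal.ofReal (-Real.negMulLog (μ.rnDeriv volume x).toReal) : ℝ≥0∞) : EReal)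
  else ⊥

/-! ### Graph tokens -/

/-- Mean aggregation: the reconstruction token of a node `v` is the mean of the hidden graph tokens
`s i` over the index set `Γ v` of the tokens associated with `v`. -/
def meanPool {V : Type*} {N m : ℕ} (Γ : V → Finset (Fin N))
    (s : Fin N → EuclideanSpace ℝ (Fin m)) : V → EuclideanSpace ℝ (Fin m) :=
  fun v => ((Γ v).card : ℝ)⁻¹ • ∑ i ∈ Γ v, s i

/-! ### Denoising diffusion

Time steps are `1, …, T`; `β t` is the variance schedule and `α t = 1 - β t`. A denoiser is a
function `f : ℕ → X → Y → X`, where `f t x h` is the noise predicted at time `t` from the noisy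
input `x` under the condition `h`. -/

/-- `ᾱ_t = ∏_{i ≤ t} (1 - β_i)`. -/
def alphaBar (β : ℕ → ℝ) (t : ℕ) : ℝ := ∏ i ∈ Finset.Icc 1 t, (1 - β i)

section
variable {ι : Type*} [Fintype ι] {Y : Type*}

/-- The density at `x` of the Gaussian law `N(m, v I)`. -/
def gaussianDensity (m : EuclideanSpace ℝ ι) (v : ℝ) (x : EuclideanSpace ℝ ι) : ℝ :=
  (2 * Real.pi * v) ^ (-(Fintype.card ι : ℝ) / 2) * Real.exp (-‖x - m‖ ^ 2 / (2 * v))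

/-- The noisy input `√ᾱ_t x + √(1 - ᾱ_t) ε`. -/
def noisy (β : ℕ → ℝ) (t : ℕ) (x ε : EuclideanSpace ℝ ι) : EuclideanSpace ℝ ι :=
  √(alphaBar β t) • x + √(1 - alphaBar β t) • ε

/-- The noise prediction loss
`L_diff = ∑_{t=1}^T w_t 𝔼 ‖f(√ᾱ_t E + √(1 - ᾱ_t) ε, H, t) - ε‖²`, where `ε` is standard Gaussian
noise independent of `(E, H)`. For `w_t = 1 / T` it is the expectation over a uniform time `t`. -/
def diffLoss {Ω : Type*} [MeasurableSpace Ω] (P : Measure Ω) (T : ℕ) (β w : ℕ → ℝ)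
    (f : ℕ → EuclideanSpace ℝ ι → Y → EuclideanSpace ℝ ι)
    (E : Ω → EuclideanSpace ℝ ι) (H : Ω → Y) : ℝ :=
  ∑ t ∈ Finset.Icc 1 T, w t *
    ∫ z, ‖f t (noisy β t (E z.1) z.2) (H z.1) - z.2‖ ^ 2
      ∂(P.prod (stdGaussian (EuclideanSpace ℝ ι)))

/-- The mean `μ_f(y, h, t) = (y - (1 - α_t) / √(1 - ᾱ_t) • f(y, h, t)) / √α_t` of the reverse
transition from time `t` to time `t - 1`. -/
def reverseMean (β : ℕ → ℝ) (f : ℕ → EuclideanSpace ℝ ι → Y → EuclideanSpace ℝ ι)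
    (t : ℕ) (y : EuclideanSpace ℝ ι) (h : Y) : EuclideanSpace ℝ ι :=
  (√(1 - β t))⁻¹ • (y - (β t / √(1 - alphaBar β t)) • f t y h)

/-- The density, given the condition `h`, of the reverse chain after `j` steps, that is, at time
`T - j`: it starts at time `T` from `N(0, I)`, and its transition from time `t` to time `t - 1` is
`N(μ_f(y, h, t), σ²_t I)`. -/
def reverseDensity (T : ℕ) (β σsq : ℕ → ℝ)
    (f : ℕ → EuclideanSpace ℝ ι → Y → EuclideanSpace ℝ ι) (h : Y) :
    ℕ → EuclideanSpace ℝ ι → ℝ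
  | 0, x => gaussianDensity 0 1 x
  | j + 1, x => ∫ y, reverseDensity T β σsq f h j y *
      gaussianDensity (reverseMean β f (T - j) y h) (σsq (T - j)) x

/-- The conditional model likelihood
`q_f(x | h) = ∫ q(x_T) ∏_{t=1}^T q_f(x_{t-1} | x_t, h) dx_1 ⋯ dx_T` at `x_0 = x`, with the integrals
carried out one after the other, from `x_T` down to `x_1`. -/
def modelLikelihood (T : ℕ) (β σsq : ℕ → ℝ)
    (f : ℕ → EuclideanSpace ℝ ι → Y → EuclideanSpace ℝ ι) (x : EuclideanSpace ℝ ι) (h : Y) : ℝ :=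
  reverseDensity T β σsq f h T x

end

/-- The reverse variance `σ²_t` for which the squared noise prediction error at time `t` has the
weight `β_t² / (2 σ²_t α_t (1 - ᾱ_t)) = w_t` in the evidence lower bound. -/
def reverseVar (β w : ℕ → ℝ) (t : ℕ) : ℝ :=
  β t ^ 2 / (2 * w t * (1 - β t) * (1 - alphaBar β t))

/-- The variance `β_t (1 - ᾱ_{t-1}) / (1 - ᾱ_t)` of the forward posterior `p(x_{t-1} | x_t, x_0)`. -/
def posteriorVar (β : ℕ → ℝ) (t : ℕ) : ℝ :=
  β t * (1 - alphaBar β (t - 1)) / (1 - alphaBar β t)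

/-- The constant of the evidence lower bound. It depends only on the dimension `n`, on the schedule
and the reverse variances, and on the second moment `M` of the data. -/
def diffConst (n T : ℕ) (β σsq : ℕ → ℝ) (M : ℝ) : ℝ :=
  (n / 2 : ℝ) * Real.log (2 * Real.pi)
    + (alphaBar β T * M + n * (1 - alphaBar β T)) / 2
    + (n / 2 : ℝ) * ∑ t ∈ Finset.Icc 1 T,
        (Real.log (σsq t / β t) + posteriorVar β t / σsq t - 1)

end Denoiser

end

/-! Two independent arguments meet in the last theorem. The evidence lower bound is proved one
reverse step at a time, not over whole paths. With `X_t = √ᾱ_t E + √(1-ᾱ_t) ε`, take the forward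
transition from `X_{t-1}` as proposal inside the integral that defines the next reverse density, and
apply Jensen. Its fresh noise and the noise of `X_{t-1}` form a standard Gaussian pair; a rotation
turns them into the noise of `X_t` and an independent standard noise. In these coordinates `X_{t-1}
- μ_f(X_t)` is a multiple of the prediction error at time `t` plus independent noise of posterior
variance. Hence each step costs its loss term plus an explicit constant
(`IsPositiveDensity.integral_log_gaussianMix_noisy`), and the terminal Gaussian supplies the rest of
`C`. For mutual information, Donsker–Varadhan (`integral_log_le_klDiv`) is applied with `Z =
q_f(g(G) | H) / p(g(G))`, where `p` is the density of `E`. Its mean under independent marginals is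
at most one because `q_f(· | h)` is a probability density; its mean logarithm under the joint law is
the entropy plus the expected log-likelihood. -/

namespace Denoiser

/-! ### Gaussian densities and moments of standard noise. -/

section Gaussian

open Real
open scoped RealInnerProductSpace

variable {ι : Type*} [Fintype ι]

lemma gaussianDensity_pos (m : EuclideanSpace ℝ ι) {v : ℝ} (hv : 0 < v) (x : EuclideanSpace ℝ ι) :
    0 < gaussianDensity m v x := by
  unfold gaussianDensity; positivity

lemma gaussianDensity_le (m : EuclideanSpace ℝ ι) {v : ℝ} (hv : 0 < v) (x : EuclideanSpace ℝ ι) :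
    gaussianDensity m v x ≤ (2 * π * v) ^ (-(Fintype.card ι : ℝ) / 2) := by
  unfold gaussianDensity
  refine mul_le_of_le_one_right (by positivity) (exp_le_one_iff.2 ?_)
  rw [neg_div]
  exact neg_nonpos.2 (by positivity)

lemma log_gaussianDensity (m : EuclideanSpace ℝ ι) {v : ℝ} (hv : 0 < v)
    (x : EuclideanSpace ℝ ι) :
    log (gaussianDensity m v x)
      = -(Fintype.card ι / 2 : ℝ) * log (2 * π * v) - ‖x - m‖ ^ 2 / (2 * v) := by
  unfold gaussianDensity
  rw [log_mul (by positivity) (exp_pos _).ne', log_exp, log_rpow (by positivity)]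
  ring

lemma measurable_gaussianDensity {α : Type*} [MeasurableSpace α] {m x : α → EuclideanSpace ℝ ι}
    (hm : Measurable m) (hx : Measurable x) (v : ℝ) :
    Measurable fun a => gaussianDensity (m a) v (x a) := by
  unfold gaussianDensity; fun_prop

lemma integrable_gaussianDensity (m : EuclideanSpace ℝ ι) {v : ℝ} (hv : 0 < v) :
    Integrable (gaussianDensity m v) := by
  have h0 : Integrable fun x : EuclideanSpace ℝ ι => exp (-(1 / (2 * v)) * ‖x‖ ^ 2) := by
    -- A non-integrable function has Bochner integral zero by default, contradicting the positive
    -- value in the Gaussian integral formula.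
    by_contra h
    have h1 := GaussianFourier.integral_rexp_neg_mul_sq_norm (V := EuclideanSpace ℝ ι)
      (show 0 < 1 / (2 * v) by positivity)
    rw [integral_undef h] at h1
    have : 0 < (π / (1 / (2 * v))) ^ (Module.finrank ℝ (EuclideanSpace ℝ ι) / 2 : ℝ) := by
      positivity
    exact this.ne h1
  have h1 := (h0.comp_sub_right m).const_mul ((2 * π * v) ^ (-(Fintype.card ι : ℝ) / 2))
  refine h1.congr (ae_of_all _ fun x => ?_)
  simp only [gaussianDensity]
  congr 2
  ring

/-- The Gaussian density is the Lebesgue density of an affine image of the standard Gaussian. -/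
lemma withDensity_gaussianDensity (m : EuclideanSpace ℝ ι) {v : ℝ} (hv : 0 < v) :
    volume.withDensity (fun x => ENNReal.ofReal (gaussianDensity m v x))
      = (stdGaussian (EuclideanSpace ℝ ι)).map fun z => m + √v • z := by
  have : IsFiniteMeasure (volume.withDensity fun x => ENNReal.ofReal (gaussianDensity m v x)) :=
    isFiniteMeasure_withDensity_ofReal (integrable_gaussianDensity m hv).2
  apply Measure.ext_of_charFun
  ext t
  have h1 : (fun z : EuclideanSpace ℝ ι => m + √v • z) = (fun z => m + z) ∘ fun z => √v • z := rfl
  rw [h1, ← Measure.map_map (by fun_prop) (by fun_prop), charFun_map_const_add, charFun_map_smul,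
    charFun_stdGaussian, charFun_apply]
  have hm : Measurable fun x : EuclideanSpace ℝ ι => (gaussianDensity m v x).toNNReal := by
    unfold gaussianDensity; fun_prop
  change ∫ x, _ ∂(volume.withDensity fun x => ((gaussianDensity m v x).toNNReal : ℝ≥0∞)) = _
  rw [integral_withDensity_eq_integral_smul hm,
    ← integral_add_left_eq_self _ m]
  have hb : 0 < ((1 / (2 * v) : ℝ) : ℂ).re := by
    rw [Complex.ofReal_re]; positivity
  -- With inverse width `1 / (2v)`, the factor `(2πv)^(n/2)` cancels the normaliser and the exponent
  -- becomes `-v‖t‖²/2`, as for `√v • z`.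
  have h2 := GaussianFourier.integral_cexp_neg_mul_sq_norm_add hb Complex.I t
  have h3 : ∀ x : EuclideanSpace ℝ ι, (gaussianDensity m v (m + x)).toNNReal •
      Complex.exp (⟪m + x, t⟫ * Complex.I)
      = (((2 * π * v) ^ (-(Fintype.card ι : ℝ) / 2) : ℝ) * Complex.exp (⟪m, t⟫ * Complex.I)) *
        Complex.exp (-((1 / (2 * v) : ℝ) : ℂ) * ‖x‖ ^ 2 + Complex.I * ⟪t, x⟫) := by
    intro x
    rw [NNReal.smul_def, Real.coe_toNNReal _ (gaussianDensity_pos m hv _).le, gaussianDensity,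
      Complex.real_smul, Complex.ofReal_mul, Complex.ofReal_exp, mul_assoc (_ : ℂ),
      mul_assoc (_ : ℂ) (Complex.exp (⟪m, t⟫ * Complex.I)),
      ← Complex.exp_add, ← Complex.exp_add, inner_add_left, real_inner_comm x t, add_sub_cancel_left]
    congr 2
    push_cast
    ring
  simp_rw [h3]
  rw [integral_const_mul, h2]
  have h4 : (π / ((1 / (2 * v) : ℝ) : ℂ)) ^ (Module.finrank ℝ (EuclideanSpace ℝ ι) / 2 : ℂ)
      = (((2 * π * v) ^ ((Fintype.card ι : ℝ) / 2) : ℝ) : ℂ) := by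
    rw [Complex.ofReal_cpow (by positivity), finrank_euclideanSpace]
    congr 1
    · push_cast
      have : (v : ℂ) ≠ 0 := by exact_mod_cast hv.ne'
      field_simp
    · push_cast
      ring
  have h5 : ((2 * π * v) ^ (-(Fintype.card ι : ℝ) / 2) : ℝ) *
      (2 * π * v) ^ ((Fintype.card ι : ℝ) / 2) = 1 := by
    rw [← rpow_add (by positivity), neg_div, neg_add_cancel, rpow_zero]
  have h6 : (((2 * π * v) ^ (-(Fintype.card ι : ℝ) / 2) : ℝ) : ℂ) *
      (((2 * π * v) ^ ((Fintype.card ι : ℝ) / 2) : ℝ) : ℂ) = 1 := by exact_mod_cast h5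
  have h7 : Complex.I ^ 2 * (‖t‖ : ℂ) ^ 2 / (4 * ((1 / (2 * v) : ℝ) : ℂ))
      = -(‖√v • t‖ : ℂ) ^ 2 / 2 := by
    rw [Complex.I_sq, norm_smul, Real.norm_of_nonneg (sqrt_nonneg v), Complex.ofReal_mul, mul_pow,
      ← Complex.ofReal_pow √v, sq_sqrt hv.le]
    push_cast
    have : (v : ℂ) ≠ 0 := by exact_mod_cast hv.ne'
    field_simp
    norm_num
  rw [h4, h7]
  linear_combination (Complex.exp (⟪m, t⟫ * Complex.I) *
    Complex.exp (-(‖√v • t‖ : ℂ) ^ 2 / 2)) * h6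

lemma integral_gaussianDensity (m : EuclideanSpace ℝ ι) {v : ℝ} (hv : 0 < v) :
    ∫ x, gaussianDensity m v x = 1 := by
  have h := congrArg (fun μ : Measure (EuclideanSpace ℝ ι) => μ Set.univ)
    (withDensity_gaussianDensity m hv)
  simp only [withDensity_apply _ MeasurableSet.univ, Measure.restrict_univ] at h
  rw [Measure.map_apply (by fun_prop) MeasurableSet.univ, Set.preimage_univ, measure_univ] at h
  rw [integral_eq_lintegral_of_nonneg_ae (ae_of_all _ fun x => (gaussianDensity_pos m hv x).le)
    (integrable_gaussianDensity m hv).1, h, ENNReal.toReal_one]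

/-- Change of variables between Lebesgue integrals against the density and expectations over
standard noise; this lets the Jensen proposal be sampled as `m + √v • z`. -/
lemma integrable_mul_gaussianDensity_iff (m : EuclideanSpace ℝ ι) {v : ℝ} (hv : 0 < v)
    {F : EuclideanSpace ℝ ι → ℝ} (hF : Measurable F) :
    Integrable (fun z => F (m + √v • z)) (stdGaussian (EuclideanSpace ℝ ι)) ↔
      Integrable (fun y => F y * gaussianDensity m v y) := by
  have hm : Measurable fun x : EuclideanSpace ℝ ι => (gaussianDensity m v x).toNNReal := by
    unfold gaussianDensity; fun_prop
  have h := withDensity_gaussianDensity m hv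
  change volume.withDensity (fun x => ((gaussianDensity m v x).toNNReal : ℝ≥0∞)) = _ at h
  have h1 := integrable_map_measure (μ := stdGaussian (EuclideanSpace ℝ ι))
    (f := fun z => m + √v • z) (g := F) hF.aestronglyMeasurable (by fun_prop)
  rw [← h, integrable_withDensity_iff_integrable_smul hm] at h1
  refine Iff.trans h1.symm (Eq.to_iff (congrArg (fun k => Integrable k volume) ?_))
  ext y
  rw [NNReal.smul_def, Real.coe_toNNReal _ (gaussianDensity_pos m hv _).le, smul_eq_mul, mul_comm]

lemma integral_mul_gaussianDensity (m : EuclideanSpace ℝ ι) {v : ℝ} (hv : 0 < v)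
    {F : EuclideanSpace ℝ ι → ℝ} (hF : Measurable F) :
    ∫ y, F y * gaussianDensity m v y
      = ∫ z, F (m + √v • z) ∂(stdGaussian (EuclideanSpace ℝ ι)) := by
  have hm : Measurable fun x : EuclideanSpace ℝ ι => (gaussianDensity m v x).toNNReal := by
    unfold gaussianDensity; fun_prop
  have h := withDensity_gaussianDensity m hv
  change volume.withDensity (fun x => ((gaussianDensity m v x).toNNReal : ℝ≥0∞)) = _ at h
  rw [← integral_map (μ := stdGaussian (EuclideanSpace ℝ ι)) (φ := fun z => m + √v • z) (f := F)
    (by fun_prop) hF.aestronglyMeasurable, ← h, integral_withDensity_eq_integral_smul hm]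
  refine integral_congr_ae (ae_of_all _ fun y => ?_)
  simp only []
  rw [NNReal.smul_def, Real.coe_toNNReal _ (gaussianDensity_pos m hv _).le, smul_eq_mul, mul_comm]

lemma integrable_norm_sq_stdGaussian :
    Integrable (fun z => ‖z‖ ^ 2) (stdGaussian (EuclideanSpace ℝ ι)) :=
  (IsGaussian.memLp_two_id (μ := stdGaussian (EuclideanSpace ℝ ι))).integrable_norm_pow two_ne_zero

lemma integral_norm_sq_stdGaussian :
    ∫ z, ‖z‖ ^ 2 ∂(stdGaussian (EuclideanSpace ℝ ι)) = Fintype.card ι := by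
  have h1 : ∫ x : ℝ, x ^ 2 ∂(gaussianReal 0 1) = 1 := by
    have := variance_of_integral_eq_zero (X := id) (μ := gaussianReal 0 1) aemeasurable_id
      (by simp [integral_id_gaussianReal])
    rw [variance_id_gaussianReal] at this
    simpa using this.symm
  rw [← map_pi_eq_stdGaussian, integral_map (by fun_prop) (by fun_prop)]
  simp_rw [EuclideanSpace.real_norm_sq_eq]
  have h2 : Integrable (fun x : ℝ => x ^ 2) (gaussianReal 0 1) :=
    (IsGaussian.memLp_two_id (μ := gaussianReal 0 1)).integrable_sq
  rw [integral_finsetSum _ fun i _ => integrable_comp_eval (μ := fun _ : ι => gaussianReal 0 1)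
    (f := fun x : ℝ => x ^ 2) h2]
  simp_rw [integral_comp_eval (μ := fun _ : ι => gaussianReal 0 1) (f := fun x : ℝ => x ^ 2)
    h2.aestronglyMeasurable, h1]
  simp

variable {Ω : Type*} [MeasurableSpace Ω]

lemma integrable_norm_sq_add_smul_noise (Q : Measure Ω) [IsProbabilityMeasure Q]
    {U : Ω → EuclideanSpace ℝ ι} (hU : Measurable U) (hU2 : Integrable (fun ω => ‖U ω‖ ^ 2) Q)
    (b : ℝ) :
    Integrable (fun z => ‖U z.1 + b • z.2‖ ^ 2) (Q.prod (stdGaussian (EuclideanSpace ℝ ι))) := by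
  have h1 : MemLp U 2 Q := (memLp_two_iff_integrable_sq_norm hU.aestronglyMeasurable).2 hU2
  have h2 : MemLp (fun z : Ω × EuclideanSpace ℝ ι => U z.1) 2
      (Q.prod (stdGaussian (EuclideanSpace ℝ ι))) := h1.comp_fst _
  have h3 : MemLp (fun z : Ω × EuclideanSpace ℝ ι => z.2) 2
      (Q.prod (stdGaussian (EuclideanSpace ℝ ι))) :=
    (IsGaussian.memLp_two_id (μ := stdGaussian (EuclideanSpace ℝ ι))).comp_snd _
  exact (h2.add (h3.const_smul b)).integrable_norm_pow two_ne_zero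

/-- The cross term vanishes because the noise is centred and independent of `U`. -/
lemma integral_norm_sq_add_smul_noise (Q : Measure Ω) [IsProbabilityMeasure Q]
    {U : Ω → EuclideanSpace ℝ ι} (hU : Measurable U) (hU2 : Integrable (fun ω => ‖U ω‖ ^ 2) Q)
    (b : ℝ) :
    ∫ z, ‖U z.1 + b • z.2‖ ^ 2 ∂(Q.prod (stdGaussian (EuclideanSpace ℝ ι)))
      = ∫ ω, ‖U ω‖ ^ 2 ∂Q + b ^ 2 * Fintype.card ι := by
  rw [integral_prod _ (integrable_norm_sq_add_smul_noise Q hU hU2 b)]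
  have h : ∀ u : EuclideanSpace ℝ ι, ∫ z, ‖u + b • z‖ ^ 2 ∂(stdGaussian (EuclideanSpace ℝ ι))
      = ‖u‖ ^ 2 + b ^ 2 * Fintype.card ι := by
    intro u
    have hid : Integrable (fun z : EuclideanSpace ℝ ι => z) (stdGaussian (EuclideanSpace ℝ ι)) :=
      IsGaussian.integrable_id
    have e : ∀ z : EuclideanSpace ℝ ι, ‖u + b • z‖ ^ 2
        = ‖u‖ ^ 2 + 2 * b * ⟪u, z⟫ + b ^ 2 * ‖z‖ ^ 2 := by
      intro z
      rw [norm_add_sq_real, inner_smul_right, norm_smul, mul_pow, Real.norm_eq_abs, sq_abs]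
      ring
    simp_rw [e]
    have hi : Integrable (fun z => 2 * b * ⟪u, z⟫) (stdGaussian (EuclideanSpace ℝ ι)) :=
      (hid.const_inner u).const_mul _
    have ha : Integrable (fun z => ‖u‖ ^ 2 + 2 * b * ⟪u, z⟫)
      (stdGaussian (EuclideanSpace ℝ ι)) := (integrable_const _).add hi
    rw [integral_add ha (integrable_norm_sq_stdGaussian.const_mul _),
      integral_add (integrable_const _) hi, integral_const_mul, integral_const_mul,
      integral_inner hid, integral_id_stdGaussian, integral_norm_sq_stdGaussian]
    simp
  simp_rw [h]
  rw [integral_add hU2 (integrable_const _)]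
  simp

end Gaussian

/-! ### One reverse step: Gaussian mixtures, Jensen and the rotation of noise. -/

section ReverseStep

open Real

variable {ι : Type*} [Fintype ι] {Y : Type*} [MeasurableSpace Y]

/-- A jointly measurable, everywhere positive family of probability densities. -/
structure IsPositiveDensity (D : EuclideanSpace ℝ ι → Y → ℝ) : Prop where
  measurable : Measurable (Function.uncurry D)
  pos : ∀ x h, 0 < D x h
  integrable : ∀ h, Integrable fun x => D x h
  integral_eq_one : ∀ h, ∫ x, D x h = 1

/-- The density of one transition of Gaussian type with mean `μ y h` and variance `v`, started from
the density `D`. -/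
noncomputable def gaussianMix (D : EuclideanSpace ℝ ι → Y → ℝ)
    (μ : EuclideanSpace ℝ ι → Y → EuclideanSpace ℝ ι) (v : ℝ) (x : EuclideanSpace ℝ ι) (h : Y) : ℝ :=
  ∫ y, D y h * gaussianDensity (μ y h) v x

variable {D : EuclideanSpace ℝ ι → Y → ℝ} {μ : EuclideanSpace ℝ ι → Y → EuclideanSpace ℝ ι} {v : ℝ}

lemma IsPositiveDensity.measurable_left (hD : IsPositiveDensity D) (h : Y) :
    Measurable fun y => D y h :=
  hD.measurable.comp (measurable_id.prodMk measurable_const)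

lemma IsPositiveDensity.integrable_mul_gaussianDensity (hD : IsPositiveDensity D)
    (hμ : Measurable (Function.uncurry μ)) (hv : 0 < v) (x : EuclideanSpace ℝ ι) (h : Y) :
    Integrable fun y => D y h * gaussianDensity (μ y h) v x := by
  have hm : Measurable fun y => gaussianDensity (μ y h) v x :=
    measurable_gaussianDensity (hμ.comp (measurable_id.prodMk measurable_const))
      measurable_const v
  refine (hD.integrable h).mul_bdd (c := (2 * π * v) ^ (-(Fintype.card ι : ℝ) / 2))
    hm.aestronglyMeasurable (ae_of_all _ fun y => ?_)
  rw [Real.norm_of_nonneg (gaussianDensity_pos _ hv _).le]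
  exact gaussianDensity_le _ hv _

lemma IsPositiveDensity.gaussianMix_le (hD : IsPositiveDensity D)
    (hμ : Measurable (Function.uncurry μ)) (hv : 0 < v) (x : EuclideanSpace ℝ ι) (h : Y) :
    gaussianMix D μ v x h ≤ (2 * π * v) ^ (-(Fintype.card ι : ℝ) / 2) := by
  have h1 := integral_mono (hD.integrable_mul_gaussianDensity hμ hv x h)
    ((hD.integrable h).mul_const ((2 * π * v) ^ (-(Fintype.card ι : ℝ) / 2)))
    fun y => mul_le_mul_of_nonneg_left (gaussianDensity_le (μ y h) hv x) (hD.pos y h).le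
  rwa [integral_mul_const, hD.integral_eq_one, one_mul] at h1

lemma IsPositiveDensity.gaussianMix (hD : IsPositiveDensity D)
    (hμ : Measurable (Function.uncurry μ)) (hv : 0 < v) :
    IsPositiveDensity (gaussianMix D μ v) := by
  have hjoint : Measurable fun z : (EuclideanSpace ℝ ι × Y) × EuclideanSpace ℝ ι =>
      D z.2 z.1.2 * gaussianDensity (μ z.2 z.1.2) v z.1.1 := by
    have hz : Measurable fun z : (EuclideanSpace ℝ ι × Y) × EuclideanSpace ℝ ι => (z.2, z.1.2) := by
      fun_prop
    exact (hD.measurable.comp hz).mul (measurable_gaussianDensity (hμ.comp hz)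
      (measurable_fst.comp measurable_fst) v)
  -- Integrating out the endpoint first leaves `D`, so the joint integrand is integrable; Fubini
  -- then gives both integrability and total mass one.
  have hint : ∀ h, Integrable (fun z : EuclideanSpace ℝ ι × EuclideanSpace ℝ ι =>
      D z.1 h * gaussianDensity (μ z.1 h) v z.2) (volume.prod volume) := by
    intro h
    have hm : Measurable fun z : EuclideanSpace ℝ ι × EuclideanSpace ℝ ι =>
        D z.1 h * gaussianDensity (μ z.1 h) v z.2 :=
      ((hD.measurable_left h).comp measurable_fst).mul (measurable_gaussianDensity
        (hμ.comp (measurable_fst.prodMk measurable_const)) measurable_snd v)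
    rw [integrable_prod_iff hm.aestronglyMeasurable]
    refine ⟨ae_of_all _ fun y => (integrable_gaussianDensity (μ y h) hv).const_mul (D y h), ?_⟩
    refine (hD.integrable h).congr (ae_of_all _ fun y => ?_)
    simp only [norm_mul, Real.norm_of_nonneg (hD.pos _ _).le,
      Real.norm_of_nonneg (gaussianDensity_pos _ hv _).le]
    rw [integral_const_mul, integral_gaussianDensity _ hv, mul_one]
  refine ⟨?_, fun x h => ?_, fun h => (hint h).integral_prod_right, fun h => ?_⟩
  · exact (hjoint.stronglyMeasurable.integral_prod_right (ν := volume)).measurable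
  · have hp : ∀ y, 0 < D y h * gaussianDensity (μ y h) v x :=
      fun y => mul_pos (hD.pos y h) (gaussianDensity_pos _ hv _)
    refine (integral_pos_iff_support_of_nonneg (fun y => (hp y).le)
      (hD.integrable_mul_gaussianDensity hμ hv x h)).2 ?_
    rw [Function.support_eq_univ fun y => (hp y).ne']
    exact Measure.measure_univ_pos.2 (NeZero.ne _)
  · unfold Denoiser.gaussianMix
    rw [integral_integral_swap (f := fun x y => D y h * gaussianDensity (μ y h) v x) (hint h).swap]
    simp_rw [integral_const_mul, integral_gaussianDensity _ hv, mul_one]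
    exact hD.integral_eq_one h

/-- Jensen by the tangent line of the logarithm at the mean `c`. -/
lemma integral_log_le_log_integral {α : Type*} [MeasurableSpace α] {Q : Measure α}
    [IsProbabilityMeasure Q] {Z : α → ℝ} (hZ : ∀ z, 0 < Z z) (hZi : Integrable Z Q)
    (hl : Integrable (fun z => log (Z z)) Q) :
    ∫ z, log (Z z) ∂Q ≤ log (∫ z, Z z ∂Q) := by
  have hc : 0 < ∫ z, Z z ∂Q := by
    refine (integral_pos_iff_support_of_nonneg (fun z => (hZ z).le) hZi).2 ?_
    rw [Function.support_eq_univ fun z => (hZ z).ne']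
    simp
  set c := ∫ z, Z z ∂Q with hcdef
  have h1 : ∀ z, log (Z z) ≤ (log c - 1) + Z z / c := by
    intro z
    have := log_le_sub_one_of_pos (div_pos (hZ z) hc)
    rw [log_div (hZ z).ne' hc.ne'] at this
    linarith
  have h2 := integral_mono hl ((integrable_const (log c - 1)).add (hZi.div_const c)) h1
  simp only [Pi.add_apply] at h2
  rw [integral_add (integrable_const _) (hZi.div_const c), integral_div, ← hcdef,
    div_self hc.ne'] at h2
  simpa using h2

/-- Jensen's inequality for the logarithm of a Gaussian mixture, with the Gaussian law `N(m, b I)`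
as proposal. -/
lemma IsPositiveDensity.integral_le_log_gaussianMix (hD : IsPositiveDensity D)
    (hμ : Measurable (Function.uncurry μ)) (hv : 0 < v) {b : ℝ} (hb : 0 < b)
    (x m : EuclideanSpace ℝ ι) (h : Y)
    (hi : Integrable (fun z => log (D (m + √b • z) h)
      + log (gaussianDensity (μ (m + √b • z) h) v x) - log (gaussianDensity m b (m + √b • z)))
      (stdGaussian (EuclideanSpace ℝ ι))) :
    ∫ z, (log (D (m + √b • z) h) + log (gaussianDensity (μ (m + √b • z) h) v x)
      - log (gaussianDensity m b (m + √b • z))) ∂(stdGaussian (EuclideanSpace ℝ ι))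
      ≤ log (Denoiser.gaussianMix D μ v x h) := by
  -- The importance weight: its mean under the proposal is the mixture.
  let F : EuclideanSpace ℝ ι → ℝ := fun y =>
    D y h * gaussianDensity (μ y h) v x / gaussianDensity m b y
  have hFpos : ∀ y, 0 < F y := fun y =>
    div_pos (mul_pos (hD.pos _ _) (gaussianDensity_pos _ hv _)) (gaussianDensity_pos _ hb _)
  have hF : Measurable F := by
    refine ((hD.measurable_left h).mul (measurable_gaussianDensity
      (hμ.comp (measurable_id.prodMk measurable_const)) measurable_const v)).div ?_
    exact measurable_gaussianDensity measurable_const measurable_id b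
  have hFg : (fun y => F y * gaussianDensity m b y)
      = fun y => D y h * gaussianDensity (μ y h) v x :=
    funext fun y => div_mul_cancel₀ _ (gaussianDensity_pos _ hb _).ne'
  have hlog : (fun z => log (D (m + √b • z) h) + log (gaussianDensity (μ (m + √b • z) h) v x)
      - log (gaussianDensity m b (m + √b • z))) = fun z => log (F (m + √b • z)) := by
    ext z
    rw [log_div (mul_pos (hD.pos _ _) (gaussianDensity_pos _ hv _)).ne'
      (gaussianDensity_pos _ hb _).ne', log_mul (hD.pos _ _).ne' (gaussianDensity_pos _ hv _).ne']
  have hFi := (integrable_mul_gaussianDensity_iff m hb hF).2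
    (hFg ▸ hD.integrable_mul_gaussianDensity hμ hv x h)
  have hFe := integral_mul_gaussianDensity m hb hF
  rw [hFg] at hFe
  rw [hlog] at hi ⊢
  rw [Denoiser.gaussianMix, hFe]
  exact integral_log_le_log_integral (fun z => hFpos _) hFi hi

variable {Ω : Type*} [MeasurableSpace Ω]

/-- A pair of independent standard Gaussians is rotation invariant; the data coordinate is left
untouched. -/
lemma measurePreserving_rotate_noise (P : Measure Ω) [IsProbabilityMeasure P] (θ : ℝ) :
    MeasurePreserving (fun z : (Ω × EuclideanSpace ℝ ι) × EuclideanSpace ℝ ι =>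
      ((z.1.1, cos θ • z.1.2 + sin θ • z.2), -sin θ • z.1.2 + cos θ • z.2))
      ((P.prod (stdGaussian (EuclideanSpace ℝ ι))).prod (stdGaussian (EuclideanSpace ℝ ι)))
      ((P.prod (stdGaussian (EuclideanSpace ℝ ι))).prod (stdGaussian (EuclideanSpace ℝ ι))) := by
  have hR : MeasurePreserving (ContinuousLinearMap.rotation (E := EuclideanSpace ℝ ι) θ)
      ((stdGaussian (EuclideanSpace ℝ ι)).prod (stdGaussian (EuclideanSpace ℝ ι)))
      ((stdGaussian (EuclideanSpace ℝ ι)).prod (stdGaussian (EuclideanSpace ℝ ι))) :=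
    ⟨by fun_prop, IsGaussian.map_rotation_eq_self (by simp) θ⟩
  have hA := measurePreserving_prodAssoc P (stdGaussian (EuclideanSpace ℝ ι))
    (stdGaussian (EuclideanSpace ℝ ι))
  exact (hA.symm.comp ((MeasurePreserving.id P).prod hR)).comp hA

/-- One step of the evidence lower bound: from the noise level `1 - a (1 - b)` to the noise level
`1 - a`. -/
lemma IsPositiveDensity.integral_log_gaussianMix_noisy (hD : IsPositiveDensity D) (P : Measure Ω)
    [IsProbabilityMeasure P] {E : Ω → EuclideanSpace ℝ ι} (hE : Measurable E) {H : Ω → Y}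
    (hH : Measurable H) {f : EuclideanSpace ℝ ι → Y → EuclideanSpace ℝ ι}
    (hf : Measurable (Function.uncurry f)) {a b : ℝ} (ha : 0 < a) (ha1 : a ≤ 1) (hb : 0 < b)
    (hb1 : b < 1) (hv : 0 < v)
    (hK : Integrable (fun z : Ω × EuclideanSpace ℝ ι =>
      log (D (√(a * (1 - b)) • E z.1 + √(1 - a * (1 - b)) • z.2) (H z.1)))
      (P.prod (stdGaussian (EuclideanSpace ℝ ι))))
    (hL : Integrable (fun z : Ω × EuclideanSpace ℝ ι =>
      ‖f (√(a * (1 - b)) • E z.1 + √(1 - a * (1 - b)) • z.2) (H z.1) - z.2‖ ^ 2)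
      (P.prod (stdGaussian (EuclideanSpace ℝ ι))))
    (hμ : ∀ y h, μ y h = (√(1 - b))⁻¹ • (y - (b / √(1 - a * (1 - b))) • f y h)) :
    Integrable (fun z : Ω × EuclideanSpace ℝ ι =>
      log (Denoiser.gaussianMix D μ v (√a • E z.1 + √(1 - a) • z.2) (H z.1)))
      (P.prod (stdGaussian (EuclideanSpace ℝ ι))) ∧
    -∫ z, log (Denoiser.gaussianMix D μ v (√a • E z.1 + √(1 - a) • z.2) (H z.1))
      ∂(P.prod (stdGaussian (EuclideanSpace ℝ ι)))
    ≤ -(∫ z, log (D (√(a * (1 - b)) • E z.1 + √(1 - a * (1 - b)) • z.2) (H z.1))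
        ∂(P.prod (stdGaussian (EuclideanSpace ℝ ι))))
      + b ^ 2 / (2 * v * (1 - b) * (1 - a * (1 - b))) *
        ∫ z, ‖f (√(a * (1 - b)) • E z.1 + √(1 - a * (1 - b)) • z.2) (H z.1) - z.2‖ ^ 2
          ∂(P.prod (stdGaussian (EuclideanSpace ℝ ι)))
      + (Fintype.card ι / 2 : ℝ) * (log (v / b) + b * (1 - a) / (1 - a * (1 - b)) / v - 1) := by
  set γ := stdGaussian (EuclideanSpace ℝ ι)
  set Q := P.prod γ
  have hb' : 0 < 1 - b := by linarith
  have ha' : 0 ≤ 1 - a := by linarith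
  set s := 1 - a * (1 - b) with hs
  have hs0 : 0 < s := by nlinarith
  have hμm : Measurable (Function.uncurry μ) := by
    have : Function.uncurry μ = fun z : EuclideanSpace ℝ ι × Y =>
        (√(1 - b))⁻¹ • (z.1 - (b / √s) • Function.uncurry f z) := by
      ext1 z; exact hμ z.1 z.2
    rw [this]; fun_prop
  -- The angle is forced by `√(1-b) √(1-a) ε + √b z = √s (cos θ ε + sin θ z)`, so that the rotated
  -- first noise is the noise of `X₂`.
  set c := √((1 - b) * (1 - a) / s) with hc
  have hc2 : c ^ 2 = (1 - b) * (1 - a) / s := sq_sqrt (by positivity)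
  have hc3 : 1 - c ^ 2 = b / s := by
    rw [hc2, eq_div_iff hs0.ne', sub_mul, div_mul_cancel₀ _ hs0.ne', hs]; ring
  have hc1 : c ≤ 1 := by
    have : 0 < b / s := by positivity
    nlinarith [sqrt_nonneg ((1 - b) * (1 - a) / s)]
  obtain ⟨θ, hcos, hsin⟩ : ∃ θ, cos θ = c ∧ sin θ = √(b / s) :=
    ⟨arccos c, cos_arccos (by linarith [sqrt_nonneg ((1 - b) * (1 - a) / s)]) hc1, by
      rw [sin_arccos, hc3]⟩
  have hcos' : cos θ = √(1 - b) * √(1 - a) / √s := by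
    rw [hcos, hc, sqrt_div (by positivity), sqrt_mul hb'.le]
  have hsin' : sin θ = √b / √s := by rw [hsin, sqrt_div hb.le]
  have hR := measurePreserving_rotate_noise (ι := ι) P θ
  set R : (Ω × EuclideanSpace ℝ ι) × EuclideanSpace ℝ ι →
      (Ω × EuclideanSpace ℝ ι) × EuclideanSpace ℝ ι := fun z =>
      ((z.1.1, cos θ • z.1.2 + sin θ • z.2), -sin θ • z.1.2 + cos θ • z.2) with hRdef
  have hsb : √b ^ 2 = b := sq_sqrt hb.le
  have hsb' : √(1 - b) ^ 2 = 1 - b := sq_sqrt hb'.le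
  have hsa' : √(1 - a) ^ 2 = 1 - a := sq_sqrt ha'
  have hss : √s ^ 2 = s := sq_sqrt hs0.le
  have hssp : 0 < √s := sqrt_pos.2 hs0
  have hsbp : 0 < √(1 - b) := sqrt_pos.2 hb'
  let X₁ : Ω × EuclideanSpace ℝ ι → EuclideanSpace ℝ ι := fun z => √a • E z.1 + √(1 - a) • z.2
  let X₂ : Ω × EuclideanSpace ℝ ι → EuclideanSpace ℝ ι := fun z =>
    √(a * (1 - b)) • E z.1 + √s • z.2
  have hX₁ : Measurable X₁ := by fun_prop
  have hX₂ : Measurable X₂ := by fun_prop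
  -- `κ² / (2v)` is the weight of the prediction error in the bound.
  let κ : ℝ := b / (√(1 - b) * √s)
  let U : Ω × EuclideanSpace ℝ ι → EuclideanSpace ℝ ι := fun z => κ • (f (X₂ z) (H z.1) - z.2)
  have hU : Measurable U := by
    have : Measurable fun z : Ω × EuclideanSpace ℝ ι => f (X₂ z) (H z.1) :=
      hf.comp (hX₂.prodMk (hH.comp measurable_fst))
    fun_prop
  have hU2e : ∀ z, ‖U z‖ ^ 2 = κ ^ 2 * ‖f (X₂ z) (H z.1) - z.2‖ ^ 2 := fun z => by
    rw [norm_smul, mul_pow, Real.norm_eq_abs, sq_abs]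
  have hU2 : Integrable (fun z => ‖U z‖ ^ 2) Q := by
    simp_rw [hU2e]; exact hL.const_mul _
  -- `η² = b (1 - a) / s` is the forward posterior variance.
  let η : ℝ := -(√(1 - a) * sin θ)
  have hstep : ∀ z : (Ω × EuclideanSpace ℝ ι) × EuclideanSpace ℝ ι,
      √(1 - b) • X₁ z.1 + √b • z.2 = X₂ (R z).1 := by
    intro z
    simp only [X₁, X₂, hRdef, hcos', hsin', sqrt_mul ha.le]
    match_scalars <;> field_simp
  -- The key decomposition: `U` sees only the data and the first rotated noise, which are
  -- independent of the second.
  have hdiff : ∀ z : (Ω × EuclideanSpace ℝ ι) × EuclideanSpace ℝ ι,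
      X₁ z.1 - μ (X₂ (R z).1) (H z.1.1) = U (R z).1 + η • (R z).2 := by
    intro z
    rw [hμ]
    simp only [U, η, κ]
    generalize f (X₂ (R z).1) _ = w
    simp only [X₁, X₂, hRdef, hcos', hsin', sqrt_mul ha.le]
    match_scalars
    · field_simp
      ring
    · field_simp
      linear_combination -√(1 - a) * hsb
    · field_simp
      linear_combination -hss + √(1 - a) ^ 2 * hsb' + (1 - b) * hsa' - hs
    · field_simp
  -- The log importance weight. The term `‖z.2‖² / 2` comes from the proposal density and keeps the
  -- unrotated fresh noise.
  let Φ : (Ω × EuclideanSpace ℝ ι) × EuclideanSpace ℝ ι → ℝ := fun z =>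
    log (D (X₂ (R z).1) (H (R z).1.1)) - ‖U (R z).1 + η • (R z).2‖ ^ 2 / (2 * v)
      + ‖z.2‖ ^ 2 / 2 + (Fintype.card ι / 2 : ℝ) * (log (2 * π * b) - log (2 * π * v))
  have hΦ : ∀ z, log (D (√(1 - b) • X₁ z.1 + √b • z.2) (H z.1.1))
      + log (gaussianDensity (μ (√(1 - b) • X₁ z.1 + √b • z.2) (H z.1.1)) v (X₁ z.1))
      - log (gaussianDensity (√(1 - b) • X₁ z.1) b (√(1 - b) • X₁ z.1 + √b • z.2)) = Φ z := by
    intro z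
    rw [log_gaussianDensity _ hv, log_gaussianDensity _ hb, add_sub_cancel_left, hstep, hdiff,
      norm_smul, Real.norm_of_nonneg (sqrt_nonneg b), mul_pow, hsb]
    simp only [Φ, hRdef]
    field_simp
    ring
  have hR1 : MeasurePreserving (fun z => (R z).1) (Q.prod γ) Q := measurePreserving_fst.comp hR
  have hΦ1 : Integrable (fun z => log (D (X₂ (R z).1) (H (R z).1.1))) (Q.prod γ) :=
    hR1.integrable_comp_of_integrable hK
  have hΦ2 : Integrable (fun z => ‖U (R z).1 + η • (R z).2‖ ^ 2 / (2 * v)) (Q.prod γ) :=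
    (hR.integrable_comp_of_integrable (integrable_norm_sq_add_smul_noise Q hU hU2 η)).div_const _
  have hΦ3 : Integrable (fun z : (Ω × EuclideanSpace ℝ ι) × EuclideanSpace ℝ ι =>
      ‖z.2‖ ^ 2 / 2) (Q.prod γ) :=
    (integrable_norm_sq_stdGaussian.comp_snd Q).div_const _
  have hΦi : Integrable Φ (Q.prod γ) := ((hΦ1.sub hΦ2).add hΦ3).add (integrable_const _)
  have hU2i : ∫ z, ‖U z‖ ^ 2 ∂Q = κ ^ 2 * ∫ z, ‖f (X₂ z) (H z.1) - z.2‖ ^ 2 ∂Q := by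
    simp_rw [hU2e]; exact integral_const_mul _ _
  have hΦe : ∫ z, Φ z ∂(Q.prod γ) = ∫ z, log (D (X₂ z) (H z.1)) ∂Q
      - (κ ^ 2 * ∫ z, ‖f (X₂ z) (H z.1) - z.2‖ ^ 2 ∂Q + η ^ 2 * Fintype.card ι) / (2 * v)
      + (Fintype.card ι : ℝ) / 2
      + (Fintype.card ι / 2 : ℝ) * (log (2 * π * b) - log (2 * π * v)) := by
    have e1 : ∫ z, log (D (X₂ (R z).1) (H (R z).1.1)) ∂(Q.prod γ)
        = ∫ z, log (D (X₂ z) (H z.1)) ∂Q := by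
      have := integral_map (μ := Q.prod γ) hR1.measurable.aemeasurable
        (f := fun z => log (D (X₂ z) (H z.1))) (by rw [hR1.map_eq]; exact hK.1)
      rw [hR1.map_eq] at this
      exact this.symm
    have e2 : ∫ z, ‖U (R z).1 + η • (R z).2‖ ^ 2 / (2 * v) ∂(Q.prod γ)
        = (κ ^ 2 * ∫ z, ‖f (X₂ z) (H z.1) - z.2‖ ^ 2 ∂Q + η ^ 2 * Fintype.card ι) / (2 * v) := by
      rw [integral_div, ← hU2i, ← integral_norm_sq_add_smul_noise Q hU hU2 η]
      have := integral_map (μ := Q.prod γ) hR.measurable.aemeasurable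
        (f := fun z => ‖U z.1 + η • z.2‖ ^ 2)
        (by rw [hR.map_eq]; exact (integrable_norm_sq_add_smul_noise Q hU hU2 η).1)
      rw [hR.map_eq] at this
      rw [this]
    have e3 : ∫ z : (Ω × EuclideanSpace ℝ ι) × EuclideanSpace ℝ ι, ‖z.2‖ ^ 2 / 2 ∂(Q.prod γ)
        = (Fintype.card ι : ℝ) / 2 := by
      rw [integral_div, integral_fun_snd (fun w : EuclideanSpace ℝ ι => ‖w‖ ^ 2),
        integral_norm_sq_stdGaussian]
      simp
    have i1 : Integrable (fun z => log (D (X₂ (R z).1) (H (R z).1.1))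
        - ‖U (R z).1 + η • (R z).2‖ ^ 2 / (2 * v)) (Q.prod γ) := hΦ1.sub hΦ2
    have i2 : Integrable (fun z => log (D (X₂ (R z).1) (H (R z).1.1))
        - ‖U (R z).1 + η • (R z).2‖ ^ 2 / (2 * v) + ‖z.2‖ ^ 2 / 2) (Q.prod γ) := i1.add hΦ3
    simp only [Φ]
    rw [integral_add i2 (integrable_const _), integral_add i1 hΦ3, integral_sub hΦ1 hΦ2, e1, e2, e3]
    simp
  -- Jensen over the fresh noise alone, for the almost every `z` at which the slice of `Φ` is
  -- integrable.
  have hlow : ∀ᵐ z ∂Q, ∫ w, Φ (z, w) ∂γ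
      ≤ log (Denoiser.gaussianMix D μ v (X₁ z) (H z.1)) := by
    filter_upwards [hΦi.prod_right_ae] with z hz
    have := hD.integral_le_log_gaussianMix hμm hv hb (X₁ z) (√(1 - b) • X₁ z) (H z.1)
      (hz.congr (ae_of_all _ fun w => (hΦ (z, w)).symm))
    refine le_trans (le_of_eq (integral_congr_ae (ae_of_all _ fun w => (hΦ (z, w)).symm))) this
  have hlowi : Integrable (fun z => ∫ w, Φ (z, w) ∂γ) Q := hΦi.integral_prod_left
  have hmeas : Measurable fun z => log (Denoiser.gaussianMix D μ v (X₁ z) (H z.1)) :=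
    ((hD.gaussianMix hμm hv).measurable.comp (hX₁.prodMk (hH.comp measurable_fst))).log
  -- Squeezed between the integrable Jensen bound and the constant bound on a Gaussian mixture.
  have hint : Integrable (fun z => log (Denoiser.gaussianMix D μ v (X₁ z) (H z.1))) Q :=
    integrable_of_le_of_le hmeas.aestronglyMeasurable hlow
      (ae_of_all _ fun z => log_le_log ((hD.gaussianMix hμm hv).pos _ _)
        (hD.gaussianMix_le hμm hv _ _)) hlowi (integrable_const _)
  refine ⟨hint, ?_⟩
  have hfin := integral_mono_ae hlowi hint hlow
  rw [← integral_prod _ hΦi, hΦe] at hfin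
  have hκ2 : κ ^ 2 = b ^ 2 / ((1 - b) * s) := by
    simp only [κ]; rw [div_pow, mul_pow, hsb', hss]
  have hη2 : η ^ 2 = (1 - a) * b / s := by
    simp only [η]; rw [neg_sq, mul_pow, hsa', hsin, sq_sqrt (by positivity)]; ring
  have hlg : log (2 * π * b) - log (2 * π * v) = -log (v / b) := by
    rw [log_mul (by positivity) hb.ne', log_mul (by positivity) hv.ne', log_div hv.ne' hb.ne']
    ring
  rw [hκ2, hη2, hlg] at hfin
  refine (neg_le_neg hfin).trans (le_of_eq ?_)
  simp only [X₂]
  field_simp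
  ring

end ReverseStep

/-! ### The noise schedule. -/

section Schedule

variable {β : ℕ → ℝ}

lemma alphaBar_succ (β : ℕ → ℝ) (t : ℕ) : alphaBar β (t + 1) = alphaBar β t * (1 - β (t + 1)) :=
  Finset.prod_Icc_succ_top (by omega) _

lemma alphaBar_pos {t : ℕ} (h : ∀ i ∈ Finset.Icc 1 t, β i < 1) : 0 < alphaBar β t :=
  Finset.prod_pos fun i hi => by linarith [h i hi]

lemma alphaBar_le_one {t : ℕ} (h : ∀ i ∈ Finset.Icc 1 t, 0 < β i ∧ β i < 1) : alphaBar β t ≤ 1 :=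
  Finset.prod_le_one (fun i hi => by linarith [(h i hi).2]) fun i hi => by linarith [(h i hi).1]

end Schedule

/-! ### The evidence lower bound by induction on reverse steps. -/

section ELBO

open Real

variable {ι : Type*} [Fintype ι] {Y : Type*} [MeasurableSpace Y] {β σsq : ℕ → ℝ} {T : ℕ}
  {f : ℕ → EuclideanSpace ℝ ι → Y → EuclideanSpace ℝ ι}

lemma measurable_reverseMean {t : ℕ} (hf : Measurable (Function.uncurry (f t))) :
    Measurable (Function.uncurry (reverseMean β f t)) := by
  change Measurable fun z : EuclideanSpace ℝ ι × Y => (√(1 - β t))⁻¹ •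
    (z.1 - (β t / √(1 - alphaBar β t)) • Function.uncurry (f t) z)
  fun_prop

lemma isPositiveDensity_reverseDensity
    (hf : ∀ t ∈ Finset.Icc 1 T, Measurable (Function.uncurry (f t)))
    (hσ : ∀ t ∈ Finset.Icc 1 T, 0 < σsq t) {j : ℕ} (hj : j ≤ T) :
    IsPositiveDensity fun x h => reverseDensity T β σsq f h j x := by
  induction j with
  | zero =>
    refine ⟨?_, fun x h => gaussianDensity_pos 0 one_pos x,
      fun h => integrable_gaussianDensity 0 one_pos, fun h => integral_gaussianDensity 0 one_pos⟩
    exact measurable_gaussianDensity measurable_const measurable_fst 1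
  | succ j ih =>
    have ht : T - j ∈ Finset.Icc 1 T := by simp only [Finset.mem_Icc]; omega
    exact (ih (by omega)).gaussianMix (measurable_reverseMean (hf _ ht)) (hσ _ ht)

variable {Ω : Type*} [MeasurableSpace Ω]

/-- The base of the induction at `t = T`: the cross-entropy of the noisy input relative to `N(0, I)`
needs only its second moment. -/
lemma integral_log_gaussianDensity_noisy (P : Measure Ω) [IsProbabilityMeasure P]
    {E : Ω → EuclideanSpace ℝ ι} (hE : Measurable E) (hE2 : Integrable (fun ω => ‖E ω‖ ^ 2) P)
    {t : ℕ} (h0 : 0 ≤ alphaBar β t) (h1 : alphaBar β t ≤ 1) :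
    Integrable (fun z : Ω × EuclideanSpace ℝ ι =>
      log (gaussianDensity 0 1 (noisy β t (E z.1) z.2)))
      (P.prod (stdGaussian (EuclideanSpace ℝ ι))) ∧
    -∫ z, log (gaussianDensity 0 1 (noisy β t (E z.1) z.2))
      ∂(P.prod (stdGaussian (EuclideanSpace ℝ ι)))
    = (Fintype.card ι / 2 : ℝ) * log (2 * π)
      + (alphaBar β t * ∫ ω, ‖E ω‖ ^ 2 ∂P + Fintype.card ι * (1 - alphaBar β t)) / 2 := by
  have hU : Measurable fun ω => √(alphaBar β t) • E ω := by fun_prop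
  have e : ∀ ω, ‖√(alphaBar β t) • E ω‖ ^ 2 = alphaBar β t * ‖E ω‖ ^ 2 := fun ω => by
    rw [norm_smul, mul_pow, Real.norm_eq_abs, sq_abs, sq_sqrt h0]
  have hU2 : Integrable (fun ω => ‖√(alphaBar β t) • E ω‖ ^ 2) P := by
    simp_rw [e]; exact hE2.const_mul _
  have hi := integrable_norm_sq_add_smul_noise P hU hU2 √(1 - alphaBar β t)
  have hv := integral_norm_sq_add_smul_noise P hU hU2 √(1 - alphaBar β t)
  simp_rw [e, integral_const_mul] at hv
  rw [sq_sqrt (by linarith)] at hv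
  simp_rw [log_gaussianDensity _ one_pos, sub_zero, mul_one, noisy]
  refine ⟨(integrable_const _).sub (hi.div_const 2), ?_⟩
  rw [integral_sub (integrable_const _) (hi.div_const 2), integral_div, hv]
  simp
  ring

/-- The diffusion evidence lower bound after `j` reverse steps. -/
lemma integral_log_reverseDensity_noisy (P : Measure Ω) [IsProbabilityMeasure P]
    {E : Ω → EuclideanSpace ℝ ι} (hE : Measurable E) (hE2 : Integrable (fun ω => ‖E ω‖ ^ 2) P)
    {H : Ω → Y} (hH : Measurable H) (hβ : ∀ t ∈ Finset.Icc 1 T, 0 < β t ∧ β t < 1)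
    (hσ : ∀ t ∈ Finset.Icc 1 T, 0 < σsq t)
    (hf : ∀ t ∈ Finset.Icc 1 T, Measurable (Function.uncurry (f t)))
    (hL : ∀ t ∈ Finset.Icc 1 T, Integrable (fun z : Ω × EuclideanSpace ℝ ι =>
      ‖f t (noisy β t (E z.1) z.2) (H z.1) - z.2‖ ^ 2)
        (P.prod (stdGaussian (EuclideanSpace ℝ ι)))) {j : ℕ} (hj : j ≤ T) :
    Integrable (fun z : Ω × EuclideanSpace ℝ ι =>
      log (reverseDensity T β σsq f (H z.1) j (noisy β (T - j) (E z.1) z.2)))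
      (P.prod (stdGaussian (EuclideanSpace ℝ ι))) ∧
    -∫ z, log (reverseDensity T β σsq f (H z.1) j (noisy β (T - j) (E z.1) z.2))
      ∂(P.prod (stdGaussian (EuclideanSpace ℝ ι)))
    ≤ (Fintype.card ι / 2 : ℝ) * log (2 * π)
      + (alphaBar β T * ∫ ω, ‖E ω‖ ^ 2 ∂P + Fintype.card ι * (1 - alphaBar β T)) / 2
      + ∑ t ∈ Finset.Ioc (T - j) T,
        (β t ^ 2 / (2 * σsq t * (1 - β t) * (1 - alphaBar β t)) *
          ∫ z, ‖f t (noisy β t (E z.1) z.2) (H z.1) - z.2‖ ^ 2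
            ∂(P.prod (stdGaussian (EuclideanSpace ℝ ι)))
        + (Fintype.card ι / 2 : ℝ) * (log (σsq t / β t) + posteriorVar β t / σsq t - 1)) := by
  induction j with
  | zero =>
    obtain ⟨h1, h2⟩ := integral_log_gaussianDensity_noisy (β := β) (t := T) P hE hE2
      (alphaBar_pos fun i hi => (hβ i hi).2).le (alphaBar_le_one hβ)
    refine ⟨h1, ?_⟩
    rw [Nat.sub_zero, Finset.Ioc_self, Finset.sum_empty, add_zero]
    exact h2.le
  | succ j ih =>
    obtain ⟨ih1, ih2⟩ := ih (by omega)
    -- Step `j + 1` leads from time `t + 1` to time `t`; `j + 1 ≤ T` keeps the natural subtraction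
    -- honest.
    obtain ⟨t, ht⟩ : ∃ t, T - j = t + 1 := ⟨T - j - 1, by omega⟩
    have ht' : T - (j + 1) = t := by omega
    have htm : t + 1 ∈ Finset.Icc 1 T := by simp only [Finset.mem_Icc]; omega
    have hβt : ∀ i ∈ Finset.Icc 1 t, 0 < β i ∧ β i < 1 := fun i hi =>
      hβ i (by simp only [Finset.mem_Icc] at hi ⊢; omega)
    rw [ht] at ih1 ih2
    have hLt := hL _ htm
    have hμ : ∀ y h, reverseMean β f (t + 1) y h = (√(1 - β (t + 1)))⁻¹ •
      (y - (β (t + 1) / √(1 - alphaBar β t * (1 - β (t + 1)))) • f (t + 1) y h) := fun y h => by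
      rw [← alphaBar_succ]; rfl
    have hstep := (isPositiveDensity_reverseDensity (β := β) hf hσ
      (by omega : j ≤ T)).integral_log_gaussianMix_noisy P hE hH (hf _ htm)
      (alphaBar_pos fun i hi => (hβt i hi).2) (alphaBar_le_one hβt) (hβ _ htm).1 (hβ _ htm).2
      (hσ _ htm) (by rw [← alphaBar_succ]; exact ih1) (by rw [← alphaBar_succ]; exact hLt) hμ
    rw [← alphaBar_succ] at hstep
    have hsucc : ∀ x h, Denoiser.gaussianMix (fun x h => reverseDensity T β σsq f h j x)
        (reverseMean β f (t + 1)) (σsq (t + 1)) x h = reverseDensity T β σsq f h (j + 1) x := by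
      intro x h
      simp only [reverseDensity, Denoiser.gaussianMix, ht]
    simp_rw [hsucc] at hstep
    rw [ht']
    refine ⟨hstep.1, hstep.2.trans ?_⟩
    have hsum : Finset.Ioc t T = insert (t + 1) (Finset.Ioc (t + 1) T) := by
      ext i; simp only [Finset.mem_Ioc, Finset.mem_insert]; omega
    rw [hsum, Finset.sum_insert (by simp)]
    have hpost : posteriorVar β (t + 1)
        = β (t + 1) * (1 - alphaBar β t) / (1 - alphaBar β (t + 1)) := rfl
    rw [hpost]
    simp only [noisy] at ih2 ⊢
    linarith

/-- The diffusion evidence lower bound for the conditional model likelihood. -/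
theorem neg_integral_log_modelLikelihood_le (P : Measure Ω) [IsProbabilityMeasure P]
    {E : Ω → EuclideanSpace ℝ ι} (hE : Measurable E) (hE2 : Integrable (fun ω => ‖E ω‖ ^ 2) P)
    {H : Ω → Y} (hH : Measurable H) (hβ : ∀ t ∈ Finset.Icc 1 T, 0 < β t ∧ β t < 1)
    (hσ : ∀ t ∈ Finset.Icc 1 T, 0 < σsq t)
    (hf : ∀ t ∈ Finset.Icc 1 T, Measurable (Function.uncurry (f t)))
    (hL : ∀ t ∈ Finset.Icc 1 T, Integrable (fun z : Ω × EuclideanSpace ℝ ι =>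
      ‖f t (noisy β t (E z.1) z.2) (H z.1) - z.2‖ ^ 2)
        (P.prod (stdGaussian (EuclideanSpace ℝ ι)))) :
    Integrable (fun ω => log (modelLikelihood T β σsq f (E ω) (H ω))) P ∧
    -∫ ω, log (modelLikelihood T β σsq f (E ω) (H ω)) ∂P
    ≤ diffLoss P T β (fun t => β t ^ 2 / (2 * σsq t * (1 - β t) * (1 - alphaBar β t))) f E H
      + diffConst (Fintype.card ι) T β σsq (∫ ω, ‖E ω‖ ^ 2 ∂P) := by
  obtain ⟨h1, h2⟩ := integral_log_reverseDensity_noisy P hE hE2 hH hβ hσ hf hL le_rfl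
  -- At time zero `ᾱ_0` is an empty product, equal to `1`, so the noise drops out.
  have hn : ∀ x ε : EuclideanSpace ℝ ι, noisy β (T - T) x ε = x := fun x ε => by
    simp [noisy, alphaBar]
  simp_rw [hn] at h1 h2
  have hm : Measurable fun ω => log (modelLikelihood T β σsq f (E ω) (H ω)) :=
    ((isPositiveDensity_reverseDensity hf hσ le_rfl).measurable.comp (hE.prodMk hH)).log
  have hfst := measurePreserving_fst (μ := P) (ν := stdGaussian (EuclideanSpace ℝ ι))
  refine ⟨(hfst.integrable_comp hm.aestronglyMeasurable).1 h1, ?_⟩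
  rw [integral_fun_fst (fun ω => log (reverseDensity T β σsq f (H ω) T (E ω)))] at h2
  simp only [probReal_univ, one_smul] at h2
  refine h2.trans (le_of_eq ?_)
  have hI : Finset.Ioc (T - T) T = Finset.Icc 1 T := by
    ext i; simp only [Finset.mem_Ioc, Finset.mem_Icc]; omega
  rw [hI, Finset.sum_add_distrib, ← Finset.mul_sum]
  simp only [diffLoss, diffConst]
  ring

end ELBO

/-! ### Donsker–Varadhan, entropy and mutual information. -/

section Information

open Real

variable {α : Type*} [MeasurableSpace α]

lemma ae_rnDeriv_toReal_pos {μ ν : Measure α} [SigmaFinite μ] [SigmaFinite ν] (hμν : μ ≪ ν) :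
    ∀ᵐ x ∂μ, 0 < (μ.rnDeriv ν x).toReal := by
  filter_upwards [Measure.rnDeriv_pos hμν, hμν.ae_le (μ.rnDeriv_ne_top ν)] with x h0 h1
    using ENNReal.toReal_pos h0.ne' h1

/-- Multiplying by the density cancels the denominator. Only an inequality holds: where the density
vanishes, the left side contributes zero and any positive part of `Z` is lost. -/
lemma lintegral_div_rnDeriv_le {μ ν : Measure α} [SigmaFinite μ] [SigmaFinite ν] (hμν : μ ≪ ν)
    {Z : α → ℝ} (hZ : Measurable Z) :
    ∫⁻ x, ENNReal.ofReal (Z x / (μ.rnDeriv ν x).toReal) ∂μ ≤ ∫⁻ x, ENNReal.ofReal (Z x) ∂ν := by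
  have hm : Measurable fun x => ENNReal.ofReal (Z x / (μ.rnDeriv ν x).toReal) :=
    (hZ.div (μ.measurable_rnDeriv ν).ennreal_toReal).ennreal_ofReal
  rw [← lintegral_rnDeriv_mul hμν hm.aemeasurable]
  refine lintegral_mono_ae ?_
  filter_upwards [μ.rnDeriv_ne_top ν] with x hx
  rw [← ENNReal.ofReal_toReal hx, ENNReal.toReal_ofReal ENNReal.toReal_nonneg,
    ← ENNReal.ofReal_mul ENNReal.toReal_nonneg]
  rcases eq_or_ne (μ.rnDeriv ν x).toReal 0 with h | h
  · simp [h]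
  · rw [mul_div_cancel₀ _ h]

/-- The Donsker–Varadhan lower bound for the Kullback–Leibler divergence. -/
lemma integral_log_le_klDiv {μ ν : Measure α} [IsProbabilityMeasure μ] [IsProbabilityMeasure ν]
    {Z : α → ℝ} (hZ : Measurable Z) (hpos : ∀ᵐ x ∂μ, 0 < Z x)
    (h1 : ∫⁻ x, ENNReal.ofReal (Z x) ∂ν ≤ 1) (hl : Integrable (fun x => log (Z x)) μ) :
    ((∫ x, log (Z x) ∂μ : ℝ) : EReal) ≤ (klDiv μ ν : EReal) := by
  by_cases htop : klDiv μ ν = ∞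
  · simp [htop]
  obtain ⟨hac, hllr⟩ := klDiv_ne_top_iff.1 htop
  have hle : ∫ x, log (Z x) ∂μ ≤ (klDiv μ ν).toReal := by
    rw [toReal_klDiv_of_measure_eq hac (by simp)]
    have hr : ∀ᵐ x ∂μ, 0 < (μ.rnDeriv ν x).toReal := ae_rnDeriv_toReal_pos hac
    have hlin := (lintegral_div_rnDeriv_le hac hZ).trans h1
    have hnn : 0 ≤ᵐ[μ] fun x => Z x / (μ.rnDeriv ν x).toReal := by
      filter_upwards [hr, hpos] with x h h' using (div_pos h' h).le
    have hm : AEStronglyMeasurable (fun x => Z x / (μ.rnDeriv ν x).toReal) μ :=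
      (hZ.div (μ.measurable_rnDeriv ν).ennreal_toReal).aestronglyMeasurable
    have hint : Integrable (fun x => Z x / (μ.rnDeriv ν x).toReal) μ :=
      ⟨hm, (hasFiniteIntegral_iff_ofReal hnn).2 (hlin.trans_lt ENNReal.one_lt_top)⟩
    have hint1 : ∫ x, Z x / (μ.rnDeriv ν x).toReal ∂μ ≤ 1 := by
      rw [integral_eq_lintegral_of_nonneg_ae hnn hm]
      exact ENNReal.toReal_le_of_le_ofReal zero_le_one (by simpa using hlin)
    -- `log u ≤ u - 1` at `u = Z / (dμ/dν)`; the right side has integral at most zero.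
    have hcmp : ∀ᵐ x ∂μ, log (Z x) - llr μ ν x ≤ Z x / (μ.rnDeriv ν x).toReal - 1 := by
      filter_upwards [hr, hpos] with x h h'
      have := log_le_sub_one_of_pos (div_pos h' h)
      rwa [log_div h'.ne' h.ne'] at this
    have h2 := integral_mono_ae (hl.sub hllr) (hint.sub (integrable_const 1)) hcmp
    simp only [Pi.sub_apply] at h2
    rw [integral_sub hl hllr, integral_sub hint (integrable_const 1)] at h2
    simp only [integral_const, probReal_univ, one_smul] at h2
    linarith
  calc ((∫ x, log (Z x) ∂μ : ℝ) : EReal) ≤ ((klDiv μ ν).toReal : EReal) := by exact_mod_cast hle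
    _ = (klDiv μ ν : EReal) := EReal.coe_ennreal_toReal htop

variable {ι : Type*} [Fintype ι]

/-- Pointwise Gibbs inequality, from `log (g / p) ≤ g / p - 1`. -/
lemma negMulLog_le {p g : ℝ} (hp : 0 ≤ p) (hg : 0 < g) : negMulLog p ≤ p * |log g| + g := by
  rcases hp.eq_or_lt with rfl | hp
  · simp [hg.le]
  have h := log_le_sub_one_of_pos (div_pos hg hp)
  rw [log_div hg.ne' hp.ne', le_sub_iff_add_le, le_div_iff₀ hp] at h
  have h2 := mul_le_mul_of_nonneg_left (neg_le_abs (log g)) hp.le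
  rw [negMulLog]
  nlinarith

/-- For a law with finite second moment the entropy is either `-∞` or the finite expectation of
`-log p`. -/
lemma diffEntropy_eq_bot_or_eq_integral (ρ : Measure (EuclideanSpace ℝ ι)) [IsProbabilityMeasure ρ]
    (hac : ρ ≪ volume) (h2 : Integrable (fun x => ‖x‖ ^ 2) ρ) :
    diffEntropy ρ = ⊥ ∨ (Integrable (fun x => log (ρ.rnDeriv volume x).toReal) ρ ∧
      diffEntropy ρ = ((-∫ x, log (ρ.rnDeriv volume x).toReal ∂ρ : ℝ) : EReal)) := by
  set p : EuclideanSpace ℝ ι → ℝ := fun x => (ρ.rnDeriv volume x).toReal with hp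
  have hpm : Measurable p := (ρ.measurable_rnDeriv volume).ennreal_toReal
  have hnm : Measurable fun x => negMulLog (p x) := continuous_negMulLog.measurable.comp hpm
  -- Comparison with the standard Gaussian, whose logarithm is quadratic and hence `ρ`-integrable:
  -- the entropy cannot be `+∞`.
  have hA : ∫⁻ x, ENNReal.ofReal (negMulLog (p x)) ≠ ∞ := by
    have hg : Integrable (fun x => |log (gaussianDensity (0 : EuclideanSpace ℝ ι) 1 x)|) ρ := by
      simp_rw [log_gaussianDensity _ one_pos, sub_zero]
      exact ((integrable_const _).sub (h2.div_const _)).abs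
    have hi : Integrable fun x => p x * |log (gaussianDensity (0 : EuclideanSpace ℝ ι) 1 x)|
        + gaussianDensity (0 : EuclideanSpace ℝ ι) 1 x :=
      ((integrable_rnDeriv_smul_iff hac).2 hg).add (integrable_gaussianDensity 0 one_pos)
    refine ((lintegral_mono fun x => ENNReal.ofReal_le_ofReal
      (negMulLog_le ENNReal.toReal_nonneg (gaussianDensity_pos 0 one_pos x))).trans_lt
      hi.lintegral_lt_top).ne
  rw [diffEntropy, if_pos hac]
  by_cases hB : ∫⁻ x, ENNReal.ofReal (-negMulLog (p x)) = ∞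
  · left
    rw [hB, EReal.coe_ennreal_top, EReal.sub_top]
  right
  have hni : Integrable fun x => negMulLog (p x) := by
    refine ⟨hnm.aestronglyMeasurable, ?_⟩
    rw [hasFiniteIntegral_iff_norm]
    refine lt_of_le_of_lt (b := ∫⁻ x, (ENNReal.ofReal (negMulLog (p x))
      + ENNReal.ofReal (-negMulLog (p x)))) (lintegral_mono fun x => ?_) ?_
    · rcases le_total 0 (negMulLog (p x)) with h | h
      · rw [Real.norm_of_nonneg h]; exact le_self_add
      · rw [Real.norm_of_nonpos h]; exact le_add_self
    · rw [lintegral_add_left hnm.ennreal_ofReal]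
      exact ENNReal.add_lt_top.2 ⟨hA.lt_top, (Ne.lt_top hB)⟩
  have hneg : (fun x => -negMulLog (p x)) = fun x => (ρ.rnDeriv volume x).toReal • log (p x) := by
    ext x; simp [negMulLog, hp]
  have hli : Integrable (fun x => log (p x)) ρ :=
    (integrable_rnDeriv_smul_iff hac).1 (hneg ▸ hni.neg)
  refine ⟨hli, ?_⟩
  rw [← integral_rnDeriv_smul hac, ← hneg, integral_neg, neg_neg,
    integral_eq_lintegral_pos_part_sub_lintegral_neg_part hni, EReal.coe_sub,
    EReal.coe_ennreal_toReal hA, EReal.coe_ennreal_toReal hB]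

/-- The variational lower bound for the mutual information through a conditional density. -/
theorem diffEntropy_add_integral_log_le_mutualInfo {Ω 𝒢 𝒮 Y : Type*} [MeasurableSpace Ω]
    [MeasurableSpace 𝒢] [MeasurableSpace 𝒮] [MeasurableSpace Y] (P : Measure Ω)
    [IsProbabilityMeasure P] {G : Ω → 𝒢} (hG : Measurable G) {s : Ω → 𝒮} (hs : Measurable s)
    {g : 𝒢 → EuclideanSpace ℝ ι} (hg : Measurable g) {φ : 𝒮 → Y} (hφ : Measurable φ)
    (hE2 : Integrable (fun ω => ‖g (G ω)‖ ^ 2) P) {D : EuclideanSpace ℝ ι → Y → ℝ}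
    (hD : IsPositiveDensity D) (hlog : Integrable (fun ω => log (D (g (G ω)) (φ (s ω)))) P) :
    diffEntropy (P.map fun ω => g (G ω)) + ((∫ ω, log (D (g (G ω)) (φ (s ω))) ∂P : ℝ) : EReal)
      ≤ (mutualInfo P G s : EReal) := by
  have hE : Measurable fun ω => g (G ω) := hg.comp hG
  set ρ := P.map fun ω => g (G ω) with hρ
  have : IsProbabilityMeasure ρ := Measure.isProbabilityMeasure_map hE.aemeasurable
  have : IsProbabilityMeasure (P.map G) := Measure.isProbabilityMeasure_map hG.aemeasurable
  have : IsProbabilityMeasure (P.map s) := Measure.isProbabilityMeasure_map hs.aemeasurable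
  have hGs : Measurable fun ω => (G ω, s ω) := hG.prodMk hs
  have : IsProbabilityMeasure (P.map fun ω => (G ω, s ω)) :=
    Measure.isProbabilityMeasure_map hGs.aemeasurable
  by_cases hac : ρ ≪ volume
  swap
  · rw [diffEntropy, if_neg hac, EReal.bot_add]; exact bot_le
  have h2 : Integrable (fun x => ‖x‖ ^ 2) ρ :=
    (integrable_map_measure (by fun_prop) hE.aemeasurable).2 hE2
  rcases diffEntropy_eq_bot_or_eq_integral ρ hac h2 with h | ⟨hpi, h⟩
  · rw [h, EReal.bot_add]; exact bot_le
  set p : EuclideanSpace ℝ ι → ℝ := fun x => (ρ.rnDeriv volume x).toReal with hp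
  have hpm : Measurable p := (ρ.measurable_rnDeriv volume).ennreal_toReal
  have hppos : ∀ᵐ ω ∂P, 0 < p (g (G ω)) :=
    ae_of_ae_map hE.aemeasurable (ae_rnDeriv_toReal_pos hac)
  have hlp : Integrable (fun ω => log (p (g (G ω)))) P :=
    (integrable_map_measure hpi.1 hE.aemeasurable).1 hpi
  -- `Z` lives on graphs and tokens themselves, so no data-processing inequality is needed to pass
  -- to `E` and `H`.
  let Z : 𝒢 × 𝒮 → ℝ := fun w => D (g w.1) (φ w.2) / p (g w.1)
  have hDm : Measurable fun w : 𝒢 × 𝒮 => D (g w.1) (φ w.2) :=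
    hD.measurable.comp ((hg.comp measurable_fst).prodMk (hφ.comp measurable_snd))
  have hZ : Measurable Z := hDm.div (hpm.comp (hg.comp measurable_fst))
  have hZ1 : ∫⁻ w, ENNReal.ofReal (Z w) ∂((P.map G).prod (P.map s)) ≤ 1 := by
    rw [lintegral_prod_symm' _ hZ.ennreal_ofReal]
    -- For fixed tokens, averaging over the graph reduces to the law of `E`, where `p` cancels and
    -- leaves the total mass of `D`.
    have hin : ∀ y, ∫⁻ x, ENNReal.ofReal (Z (x, y)) ∂(P.map G) ≤ 1 := by
      intro y
      have hDy := hD.measurable_left (φ y)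
      have hDp : Measurable fun x => ENNReal.ofReal (D x (φ y) / p x) :=
        (hDy.div hpm).ennreal_ofReal
      have e1 : ∫⁻ x, ENNReal.ofReal (Z (x, y)) ∂(P.map G)
          = ∫⁻ x, ENNReal.ofReal (D x (φ y) / p x) ∂ρ := by
        rw [hρ, show (fun ω => g (G ω)) = g ∘ G from rfl, ← Measure.map_map hg hG,
          lintegral_map hDp hg]
      rw [e1]
      refine (lintegral_div_rnDeriv_le hac hDy).trans (le_of_eq ?_)
      rw [← ofReal_integral_eq_lintegral_ofReal (hD.integrable _)
        (ae_of_all _ fun x => (hD.pos x _).le), hD.integral_eq_one, ENNReal.ofReal_one]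
    exact (lintegral_mono hin).trans (by simp)
  have hlogZ : (fun ω => log (Z (G ω, s ω))) =ᵐ[P]
      fun ω => log (D (g (G ω)) (φ (s ω))) - log (p (g (G ω))) := by
    filter_upwards [hppos] with ω hω
    exact log_div (hD.pos _ _).ne' hω.ne'
  have hZpos : ∀ᵐ w ∂(P.map fun ω => (G ω, s ω)), 0 < Z w := by
    rw [ae_map_iff hGs.aemeasurable (measurableSet_lt measurable_const hZ)]
    filter_upwards [hppos] with ω hω using div_pos (hD.pos _ _) hω
  have hZi : Integrable (fun w => log (Z w)) (P.map fun ω => (G ω, s ω)) :=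
    (integrable_map_measure hZ.log.aestronglyMeasurable hGs.aemeasurable).2
      ((hlog.sub hlp).congr hlogZ.symm)
  have hkl := integral_log_le_klDiv hZ hZpos hZ1 hZi
  rw [integral_map hGs.aemeasurable hZ.log.aestronglyMeasurable, integral_congr_ae hlogZ,
    integral_sub hlog hlp] at hkl
  rw [h, hρ, integral_map hE.aemeasurable hpi.1, ← EReal.coe_add]
  refine le_trans (le_of_eq ?_) hkl
  congr 1
  ring

end Information

lemma measurable_meanPool {V : Type*} {N m : ℕ} (Γ : V → Finset (Fin N)) :
    Measurable (meanPool (m := m) Γ) := by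
  refine measurable_pi_iff.2 fun v => ?_
  unfold meanPool
  fun_prop

end Denoiser

/-- `G` is the random graph, `E = g(G)` its latent node representations (`d` coordinates for each
node in `V`), `s` the hidden graph tokens, `H = meanPool Γ s`, `f` the denoiser (with the projection
of the condition included in it), `lam` the time weights of the loss and `lamL` its scaling factor. -/
theorem mainTheorem5 {Ω 𝒢 V : Type*} [MeasurableSpace Ω] [MeasurableSpace 𝒢] [Fintype V]
    (d m N T : ℕ) (hT : 1 ≤ T)
    (β : ℕ → ℝ) (hβ : ∀ t ∈ Finset.Icc 1 T, 0 < β t ∧ β t < 1)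
    (lam : ℕ → ℝ) (hlam : ∀ t ∈ Finset.Icc 1 T, 0 < lam t)
    (lamL : ℝ) (hlamL : 0 < lamL)
    (P : Measure Ω) [IsProbabilityMeasure P]
    (G : Ω → 𝒢) (hG : Measurable G)
    (g : 𝒢 → EuclideanSpace ℝ (V × Fin d)) (hg : Measurable g)
    (hE : Integrable (fun ω => ‖g (G ω)‖ ^ 2) P)
    (s : Ω → Fin N → EuclideanSpace ℝ (Fin m)) (hs : Measurable s)
    (Γ : V → Finset (Fin N))
    (f : ℕ → EuclideanSpace ℝ (V × Fin d) → (V → EuclideanSpace ℝ (Fin m)) →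
      EuclideanSpace ℝ (V × Fin d))
    (hf : ∀ t ∈ Finset.Icc 1 T, Measurable (Function.uncurry (f t)))
    (hL : ∀ t ∈ Finset.Icc 1 T,
      Integrable (fun z : Ω × EuclideanSpace ℝ (V × Fin d) =>
          ‖f t (Denoiser.noisy β t (g (G z.1)) z.2) (Denoiser.meanPool Γ (s z.1)) - z.2‖ ^ 2)
        (P.prod (stdGaussian (EuclideanSpace ℝ (V × Fin d))))) :
    let E : Ω → EuclideanSpace ℝ (V × Fin d) := fun ω => g (G ω)
    let H : Ω → V → EuclideanSpace ℝ (Fin m) := fun ω => Denoiser.meanPool Γ (s ω)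
    let L : ℝ := Denoiser.diffLoss P T β lam f E H
    let σsq : ℕ → ℝ := Denoiser.reverseVar β (fun t => lamL * lam t)
    let C : ℝ := Denoiser.diffConst (Fintype.card (V × Fin d)) T β σsq (∫ ω, ‖E ω‖ ^ 2 ∂P)
    let logq : Ω → ℝ := fun ω => Real.log (Denoiser.modelLikelihood T β σsq f (E ω) (H ω))
    -- the evidence lower bound for the conditional model likelihood
    Integrable logq P ∧ -(∫ ω, logq ω ∂P) ≤ lamL * L + C ∧
    -- the variational lower bound for the mutual information
    Denoiser.diffEntropy (P.map E) + ((∫ ω, logq ω ∂P : ℝ) : EReal)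
      ≤ (Denoiser.mutualInfo P G s : EReal) ∧
    -- the lower bound through the noise prediction loss
    Denoiser.diffEntropy (P.map E) - ((lamL * L + C : ℝ) : EReal)
      ≤ (Denoiser.mutualInfo P G s : EReal) := by
  intro E H L σsq C logq
  have hEm : Measurable E := hg.comp hG
  have hHm : Measurable H := (Denoiser.measurable_meanPool Γ).comp hs
  have hbar : ∀ t ∈ Finset.Icc 1 T, 0 < 1 - Denoiser.alphaBar β t := by
    intro t ht
    -- Since `t ≥ 1`, a factor `1 - β_t < 1` splits off, making `ᾱ_t < 1` strict.
    obtain ⟨k, rfl⟩ : ∃ k, t = k + 1 := ⟨t - 1, by simp only [Finset.mem_Icc] at ht; omega⟩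
    have hk : ∀ i ∈ Finset.Icc 1 k, 0 < β i ∧ β i < 1 := fun i hi =>
      hβ i (by simp only [Finset.mem_Icc] at hi ht ⊢; omega)
    rw [Denoiser.alphaBar_succ]
    nlinarith [Denoiser.alphaBar_pos fun i hi => (hk i hi).2, Denoiser.alphaBar_le_one hk,
      (hβ _ ht).1, (hβ _ ht).2]
  have hα : ∀ t ∈ Finset.Icc 1 T, 0 < 1 - β t := fun t ht => by linarith [(hβ t ht).2]
  have hσ : ∀ t ∈ Finset.Icc 1 T, 0 < σsq t := by
    intro t ht
    have := hbar t ht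
    have := hα t ht
    have := (hβ t ht).1
    have := hlam t ht
    simp only [σsq, Denoiser.reverseVar]
    positivity
  -- The reverse variances are chosen so that the weights in the bound become `lamL * lam t`.
  have hloss : Denoiser.diffLoss P T β (fun t => β t ^ 2 /
      (2 * σsq t * (1 - β t) * (1 - Denoiser.alphaBar β t))) f E H = lamL * L := by
    simp only [L, Denoiser.diffLoss, Finset.mul_sum]
    refine Finset.sum_congr rfl fun t ht => ?_
    rw [← mul_assoc]
    congr 1
    have := (hbar t ht).ne'
    have := (hα t ht).ne'
    have := (hβ t ht).1.ne'
    have := (hlam t ht).ne'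
    have := hlamL.ne'
    simp only [σsq, Denoiser.reverseVar]
    field_simp
  obtain ⟨hint, helbo⟩ := Denoiser.neg_integral_log_modelLikelihood_le P hEm hE hHm hβ hσ hf hL
  rw [hloss] at helbo
  have hmi := Denoiser.diffEntropy_add_integral_log_le_mutualInfo P hG hs hg
    (Denoiser.measurable_meanPool Γ) hE
    (Denoiser.isPositiveDensity_reverseDensity (β := β) hf hσ le_rfl) hint
  refine ⟨hint, helbo, hmi, le_trans ?_ hmi⟩
  rw [sub_eq_add_neg, ← EReal.coe_neg]
  gcongr
  exact neg_le.1 helbo
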